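/- **Setting.** Let $f:\mathbb{R}^n\to\mathbb{R}\cup\{+\infty\}$ and $h,g:\mathbb{R}^n\to\mathbb{R}$, put $\mathrm{dom}\,f=\{x: f(x)<+\infty\}$ and $\Omega=\{x: g(x)\ne0\}$, and let $F=(f+h)/g$ on $\mathrm{dom}\,f\cap\Omega$ and $F=+\infty$ elsewhere. For $\delta\ge0$, $\partial_\delta f(x)=\{d: f(y)\ge f(x)+\langle d,y-x\rangle-\delta\ \ \forall y\}$ for $x\in\mathrm{dom}\,f$ (so $\partial_0$ is the convex subdifferential), and $\partial F$ is the limiting subdifferential. Assume: - (A) $f$ is proper, lower semicontinuous and convex; $h$ is $C^1$ and $\nabla h$ is Lipschitz with constant $L_h>0$; $g$ is continuous and convex on $\mathbb{R}^n$, and positive on $\mathrm{dom}\,f\cap\Omega$; $f+h\ge0$ on $\mathrm{dom}\,f$, and $f(x)+h(x)>0$ whenever $g(x)=0$; every level set $\{F\le\alpha\}$, $\alpha\in\mathbb{R}$, is bounded. - (B) $f$ is locally Lipschitz on $\mathrm{dom}\,f$ (relative to $\mathrm{dom}\,f$). - (C) $g$ is $C^1$ on $\Omega$ with locally Lipschitz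 gradient there. Let $\{\varepsilon_k\}_{k\ge0}$ be nonnegative and let $\{H_k\}_{k\ge0}$ be symmetric positive definite matrices with $\underline\gamma I\preceq H_k\preceq\overline\gamma I$ for all $k$, where $L_h/2<\underline\gamma\le\overline\gamma$. Let $\{x^k\}_{k\ge0}\subset\mathrm{dom}\,f\cap\Omega$ be an infinite sequence generated by the inexact variable metric proximal gradient-subgradient algorithm: for all $k\ge0$, with $c_k=F(x^k)$, there are $y^k\in\partial g(x^k)$, $\Delta^k\in\mathbb{R}^n$ and $\delta_k\ge0$ such that $$\Delta^k\in\partial_{\delta_k}f(x^{k+1})+\nabla h(x^k)-c_ky^k+H_k(x^{k+1}-x^k),$$ $$\|\Delta^k\|^2+|\langle\Delta^k,x^{k+1}-x^k\rangle|+\delta_k\le\varepsilon_k\,g(x^{k+1}).$$ - (D) Assume that $\delta_k=0$ for all sufficiently large $k$. Finally, assume that $F$ is a KL function with exponent $\theta_F\in[0,1)$: for every $\tilde x$ with $\partial F(\tilde x)\ne\emptyset$ there are $a,\mu,\nu>0$ such that $\mathrm{dist}(0,\partial F(x))\ge a\,(F(x)-F(\tilde x))^{\theta_F}$ whenever $\partial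 F(x)\ne\emptyset$, $\|x-\tilde x\|\le\mu$ and $F(\tilde x)<F(x)<F(\tilde x)+\nu$. **Theorem.** Let $\varepsilon_0>0$, and suppose that either $\varepsilon_k=\varepsilon_0q^k$ for all $k\ge0$ with some $q\in(0,1)$ (geometric errors), or $\varepsilon_k=\varepsilon_0/(k+1)^q$ for all $k\ge0$ with some $q>2$ (polynomial errors). Then $\{x^k\}$ converges to some $x^*$, and as $k\to\infty$: - (i) If $\theta_F\in[0,\tfrac12]$: for geometric errors there is $\varrho\in(0,1)$ with $\|x^k-x^*\|=O(\varrho^k)$; for polynomial errors $\|x^k-x^*\|=O\big(k^{-(q/2-1)}\big)$. - (ii) If $\theta_F\in(\tfrac12,1)$: for geometric errors $\|x^k-x^*\|=O\big(k^{-\frac{1-\theta_F}{2\theta_F-1}}\big)$; for polynomial errors $\|x^k-x^*\|=O\big(k^{-(q/2-1)}\big)$ if $q<\frac{2\theta_F}{2\theta_F-1}$, and $\|x^k-x^*\|=O\big(k^{-\frac{1-\theta_F}{2\theta_F-1}}\big)$ otherwise. -/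

import Mathlib

open Filter Topology Asymptotics

/-- `ℝⁿ` with its Euclidean norm and inner product. -/
abbrev Rn (n : ℕ) : Type := EuclideanSpace ℝ (Fin n)

section Subdifferentials

variable {n : ℕ}

/-- The effective domain `dom φ` of an extended-real-valued function. -/
def effDom (φ : Rn n → EReal) : Set (Rn n) := {x | φ x < ⊤}

/-- A proper function: it never takes the value `-∞`, and its domain is nonempty. -/
def IsProperFun (φ : Rn n → EReal) : Prop :=
  (∀ x, φ x ≠ ⊥) ∧ (effDom φ).Nonempty

/-- Convexity of an extended-real-valued function, i.e. convexity of its epigraph. -/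
def IsConvexFun (φ : Rn n → EReal) : Prop :=
  Convex ℝ {p : Rn n × ℝ | φ p.1 ≤ (p.2 : EReal)}

/-- The `δ`-subdifferential of convex analysis at a point of the domain; for `δ = 0` it is the
usual convex subdifferential. -/
def epsSubdiff (δ : ℝ) (φ : Rn n → EReal) (x : Rn n) : Set (Rn n) :=
  {d | x ∈ effDom φ ∧
    ∀ y, φ x + ((inner ℝ d (y - x) - δ : ℝ) : EReal) ≤ φ y}

/-- The regular (Fréchet) subdifferential; it is empty where `φ` is not finite. -/
def regSubdiff (φ : Rn n → EReal) (x : Rn n) : Set (Rn n) :=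
  {d | φ x ≠ ⊥ ∧ φ x ≠ ⊤ ∧
    0 ≤ liminf (fun y => (φ y - φ x - ((inner ℝ d (y - x) : ℝ) : EReal)) /
      ((‖y - x‖ : ℝ) : EReal)) (𝓝[≠] x)}

/-- The limiting subdifferential; it is empty where `φ` is not finite. -/
def limSubdiff (φ : Rn n → EReal) (x : Rn n) : Set (Rn n) :=
  {d | φ x ≠ ⊥ ∧ φ x ≠ ⊤ ∧
    ∃ (u : ℕ → Rn n) (v : ℕ → Rn n),
      Tendsto u atTop (𝓝 x) ∧ Tendsto (fun k => φ (u k)) atTop (𝓝 (φ x)) ∧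
      Tendsto v atTop (𝓝 d) ∧ ∀ k, v k ∈ regSubdiff φ (u k)}

/-- `φ` has the Kurdyka-Łojasiewicz property with exponent `θ` at `x₀`. -/
def HasKLExponentAt (φ : Rn n → EReal) (θ : ℝ) (x₀ : Rn n) : Prop :=
  ∃ a > (0 : ℝ), ∃ μ > (0 : ℝ), ∃ ν > (0 : ℝ),
    ∀ x, (limSubdiff φ x).Nonempty → ‖x - x₀‖ ≤ μ →
      φ x₀ < φ x → φ x < φ x₀ + (ν : EReal) →
      a * ((φ x).toReal - (φ x₀).toReal) ^ θ ≤ Metric.infDist 0 (limSubdiff φ x)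

/-- `φ` (proper and closed) is a KL function with exponent `θ`: it has the KL property with
this same exponent at every point of the domain of its limiting subdifferential. -/
def IsKLFunctionWithExponent (φ : Rn n → EReal) (θ : ℝ) : Prop :=
  ∀ x₀, (limSubdiff φ x₀).Nonempty → HasKLExponentAt φ θ x₀

end Subdifferentials

section Problem

variable {n : ℕ}

/-- The set `Ω` of points at which the denominator does not vanish. -/
def denomSet (g : Rn n → ℝ) : Set (Rn n) := {x | g x ≠ 0}

/-- The ratio `(f x + h x) / g x`, meaningful on `dom f ∩ Ω`. -/
noncomputable def ratio (f : Rn n → EReal) (h g : Rn n → ℝ) (x : Rn n) : ℝ :=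
  ((f x).toReal + h x) / g x

open Classical in
/-- The extended objective `F`: the ratio on `dom f ∩ Ω`, and `+∞` elsewhere. -/
noncomputable def fracObj (f : Rn n → EReal) (h g : Rn n → ℝ) (x : Rn n) : EReal :=
  if x ∈ effDom f ∩ denomSet g then ((ratio f h g x : ℝ) : EReal) else ⊤

/-- The basic assumptions on `f`, `h`, `g`; `L` is a Lipschitz constant of `∇h`. -/
structure BasicAssumptions (f : Rn n → EReal) (h g : Rn n → ℝ) (L : ℝ) : Prop where
  f_proper : IsProperFun f
  f_closed : LowerSemicontinuous f
  f_convex : IsConvexFun f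
  h_contDiff : ContDiff ℝ 1 h
  L_pos : 0 < L
  grad_lipschitz : ∀ x y, ‖gradient h x - gradient h y‖ ≤ L * ‖x - y‖
  g_continuous : Continuous g
  g_convex : ConvexOn ℝ Set.univ g
  g_pos : ∀ x ∈ effDom f ∩ denomSet g, 0 < g x
  num_nonneg : ∀ x ∈ effDom f, 0 ≤ f x + (h x : EReal)
  num_pos : ∀ x, g x = 0 → 0 < f x + (h x : EReal)
  level_bounded : ∀ α : ℝ, Bornology.IsBounded {x | fracObj f h g x ≤ (α : EReal)}

/-- `x` is an (infinite) sequence generated by the inexact variable metric proximal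
gradient-subgradient algorithm with tolerances `ε` and metrics `H`; `y k` is the chosen
subgradient of `g`, and `(Δ k, δ k)` is the error pair of the `k`-th iteration. -/
structure IsIVPGSASequence (f : Rn n → EReal) (h g : Rn n → ℝ) (ε : ℕ → ℝ)
    (H : ℕ → Matrix (Fin n) (Fin n) ℝ) (x y Δ : ℕ → Rn n) (δ : ℕ → ℝ) : Prop where
  tol_nonneg : ∀ k, 0 ≤ ε k
  metric_posDef : ∀ k, (H k).PosDef
  mem_dom : ∀ k, x k ∈ effDom f ∩ denomSet g
  subgrad : ∀ k, y k ∈ epsSubdiff 0 (fun z => (g z : EReal)) (x k)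
  delta_nonneg : ∀ k, 0 ≤ δ k
  inexact : ∀ k, ∃ d ∈ epsSubdiff (δ k) f (x (k + 1)),
    Δ k = d + gradient h (x k) - ratio f h g (x k) • y k
      + Matrix.toEuclideanLin (H k) (x (k + 1) - x k)
  criterion : ∀ k, ‖Δ k‖ ^ 2 + |inner ℝ (Δ k) (x (k + 1) - x k)| + δ k
    ≤ ε k * g (x (k + 1))

end Problem

/-! The proof is a Lyapunov argument. Write `s k = ‖x (k + 1) - x k‖` and let `E` be a nonnegative
null sequence with `ε k ≤ E k - E (k + 1)`. The quadratic upper bound for `h`, the subgradient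
inequalities for `f` and `g` and the stopping criterion show that `F (x k) + E k` decreases by at
least a multiple of `s k ^ 2 + ‖Δ k‖ ^ 2` (`IsIVPGSASequence.sufficient_decrease`). Hence the
iterates stay in a sublevel set of `F`. This set is compact and `g` is bounded away from `0` on it,
because the numerator is positive where `g` vanishes (`BasicAssumptions.isCompact_sublevel`); so
the ratio and `∇g` are Lipschitz there. Once `δ k = 0`, the quotient rule
`smul_mem_regSubdiff_fracObj` turns the inclusion of the algorithm into a regular subgradient of
`F` at `x (k + 1)` of norm at most a multiple of `s k + ‖Δ k‖`.

Let `r k = F (x k) - lim F (x j) + E k`. The KL property, made uniform along the sequence by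
compactness (`IsKLFunctionWithExponent.eventually_mul_rpow_le`), gives
`(r (k + 1) - E (k + 1)) ^ (2 θ') ≤ C (r k - r (k + 1))` for every `θ' ≥ θ`. With
`θ' = (p + 1) / (2 p)` and `E k = O(k ^ (-p))` an induction yields `r k = O(k ^ (-p))`
(`exists_le_mul_rpow_neg_of_recursion`); with `θ' = 1 / 2` and geometric `E` the decay of `r` is
geometric. Finally `s k ^ 2 ≤ A (r k - r (k + 1))` and Cauchy–Schwarz on dyadic blocks give both
the convergence of `x` and the rate `k ^ (-(p - 1) / 2)`
(`exists_tendsto_isBigO_rpow_of_step_sq_le`). All polynomial rates of the theorem are instances of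
this one: `p = q - 1` when the tolerances dominate, `p = 1 / (2 θ - 1)` when the KL exponent does. -/

/-! ### Decay of recursively bounded real sequences -/

/-- The graph of the convex function `t ↦ t ^ (-p)` lies above its tangents. -/
lemma Real.rpow_neg_ge_tangent {p u v : ℝ} (hp : 0 ≤ p) (hu : 0 < u) (hv : 0 < v) :
    u ^ (-p) - p * u ^ (-(p + 1)) * (v - u) ≤ v ^ (-p) := by
  have hw : 0 < v / u := div_pos hv hu
  have h1 : 1 - p * (v / u - 1) ≤ (v / u) ^ (-p) := by
    rw [Real.rpow_def_of_pos hw]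
    have h2 := Real.add_one_le_exp (Real.log (v / u) * -p)
    have h3 := Real.log_le_sub_one_of_pos hw
    nlinarith
  have h4 : v ^ (-p) = u ^ (-p) * (v / u) ^ (-p) := by
    rw [← Real.mul_rpow hu.le hw.le, mul_div_cancel₀ _ hu.ne']
  have h5 : u ^ (-p) = u ^ (-(p + 1)) * u := by
    rw [← Real.rpow_add_one hu.ne']; congr 1; ring
  have h6 : u ^ (-p) * (1 - p * (v / u - 1)) = u ^ (-p) - p * u ^ (-(p + 1)) * (v - u) := by
    rw [h5]; field_simp
  rw [h4, ← h6]
  exact mul_le_mul_of_nonneg_left h1 (Real.rpow_nonneg hu.le _)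

/-- The discrete analogue of the differential inequality `r ^ ((p + 1) / p) ≤ -C r'`, perturbed by
a term of order `k ^ (-p)`: its solutions decay like `k ^ (-p)`. -/
lemma exists_le_mul_rpow_neg_of_recursion {r E : ℕ → ℝ} {p B C : ℝ} (hp : 0 < p) (hC : 0 < C)
    {K : ℕ} (hK : 1 ≤ K) (hE : ∀ k ≥ K, E k ≤ B * (k : ℝ) ^ (-p))
    (hrec : ∀ k ≥ K, E (k + 1) < r (k + 1) →
      (r (k + 1) - E (k + 1)) ^ ((p + 1) / p) ≤ C * (r k - r (k + 1))) :
    ∃ M > 0, ∀ k ≥ K, r k ≤ M * (k : ℝ) ^ (-p) := by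
  set G : ℝ := 2 * C * p * 2 ^ (p + 1) with hG
  have hGpos : 0 < G := by positivity
  set M : ℝ := max (2 * G ^ p) (max (2 * B) (r K * (K : ℝ) ^ p)) with hM
  have hMG : G ^ p ≤ M / 2 := by
    have : 2 * G ^ p ≤ M := le_max_left _ _
    linarith
  have hMB : B ≤ M / 2 := by
    have : 2 * B ≤ M := (le_max_left _ _).trans (le_max_right _ _)
    linarith
  have hMK : r K * (K : ℝ) ^ p ≤ M := (le_max_right _ _).trans (le_max_right _ _)
  have hMpos : 0 < M := by
    have : 0 < G ^ p := Real.rpow_pos_of_pos hGpos p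
    linarith
  refine ⟨M, hMpos, fun k hk => ?_⟩
  induction k, hk using Nat.le_induction with
  | base =>
    have hK0 : (0 : ℝ) < K := by exact_mod_cast hK
    rw [Real.rpow_neg hK0.le, ← div_eq_mul_inv, le_div_iff₀ (Real.rpow_pos_of_pos hK0 p)]
    exact hMK
  | succ k hk ih =>
    by_contra hcon
    push Not at hcon
    have hk1 : (1 : ℝ) ≤ k := by exact_mod_cast hK.trans hk
    have hk0 : (0 : ℝ) < k := by linarith
    have hk2 : (0 : ℝ) < (k : ℝ) + 1 := by linarith
    have hEk := hE (k + 1) (by omega)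
    push_cast at hcon hEk
    set t : ℝ := ((k : ℝ) + 1) ^ (-p) with ht
    have htpos : 0 < t := Real.rpow_pos_of_pos hk2 _
    have hlow : M / 2 * t ≤ r (k + 1) - E (k + 1) := by nlinarith
    have hlt : E (k + 1) < r (k + 1) := by nlinarith
    have h1 := hrec k hk hlt
    have h2 : (M / 2 * t) ^ ((p + 1) / p) ≤ (r (k + 1) - E (k + 1)) ^ ((p + 1) / p) :=
      Real.rpow_le_rpow (by positivity) hlow (by positivity)
    have h3 : (M / 2 * t) ^ ((p + 1) / p)
        = (M / 2) ^ ((p + 1) / p) * ((k : ℝ) + 1) ^ (-(p + 1)) := by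
      rw [Real.mul_rpow (by positivity) htpos.le, ht, ← Real.rpow_mul hk2.le]
      congr 2
      field_simp
    have h4 : M / 2 * G ≤ (M / 2) ^ ((p + 1) / p) := by
      have e : (p + 1) / p = 1 + 1 / p := by field_simp
      rw [e, Real.rpow_add (by positivity), Real.rpow_one]
      refine mul_le_mul_of_nonneg_left ?_ (by positivity)
      calc G = (G ^ p) ^ (1 / p) := by
            rw [← Real.rpow_mul hGpos.le, mul_one_div_cancel hp.ne', Real.rpow_one]
        _ ≤ _ := Real.rpow_le_rpow (by positivity) hMG (by positivity)
    have h5 : (k : ℝ) ^ (-p) - t ≤ p * (k : ℝ) ^ (-(p + 1)) := by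
      have := Real.rpow_neg_ge_tangent hp.le hk0 hk2
      linarith
    have h6 : (k : ℝ) ^ (-(p + 1)) ≤ 2 ^ (p + 1) * ((k : ℝ) + 1) ^ (-(p + 1)) := by
      have e : (2 : ℝ) ^ (p + 1) * ((k : ℝ) + 1) ^ (-(p + 1)) = (((k : ℝ) + 1) / 2) ^ (-(p + 1)) := by
        rw [Real.div_rpow hk2.le (by norm_num), Real.rpow_neg (by norm_num : (0 : ℝ) ≤ 2)]
        field_simp
      rw [e]
      exact Real.rpow_le_rpow_of_nonpos (by positivity) (by linarith) (by linarith)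
    have h7 : C * (r k - r (k + 1)) < C * (M * ((k : ℝ) ^ (-p) - t)) :=
      mul_lt_mul_of_pos_left (by linarith) hC
    have h8 : C * (M * ((k : ℝ) ^ (-p) - t))
        ≤ C * (M * (p * (2 ^ (p + 1) * ((k : ℝ) + 1) ^ (-(p + 1))))) := by
      gcongr
      exact h5.trans (by gcongr)
    have h9 : C * (M * (p * (2 ^ (p + 1) * ((k : ℝ) + 1) ^ (-(p + 1)))))
        = M / 2 * G * ((k : ℝ) + 1) ^ (-(p + 1)) := by rw [hG]; ring
    have h10 : M / 2 * G * ((k : ℝ) + 1) ^ (-(p + 1))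
        ≤ (M / 2) ^ ((p + 1) / p) * ((k : ℝ) + 1) ^ (-(p + 1)) := by gcongr
    linarith

/-- A contraction perturbed by a geometric term decays geometrically. -/
lemma exists_le_mul_pow_of_recursion {r E : ℕ → ℝ} {q B C : ℝ} (hq1 : q < 1)
    (hB : 0 ≤ B) (hC : 0 < C) (hq0 : 0 < q) {K : ℕ} (hE : ∀ k, E k ≤ B * q ^ k)
    (hrec : ∀ k ≥ K, r (k + 1) - E (k + 1) ≤ C * (r k - r (k + 1))) :
    ∃ ρ, 0 < ρ ∧ ρ < 1 ∧ ∃ M > 0, ∀ k ≥ K, r k ≤ M * ρ ^ k := by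
  set ρ : ℝ := max q ((C + 1 / 2) / (C + 1)) with hρ
  have hqρ : q ≤ ρ := le_max_left _ _
  have hρ0 : 0 < ρ := hq0.trans_le hqρ
  have hρ1 : ρ < 1 := max_lt hq1 ((div_lt_one (by linarith)).2 (by linarith))
  have hCρ : C + 1 / 2 ≤ ρ * (C + 1) := (div_le_iff₀ (by linarith)).1 (le_max_right _ _)
  set M : ℝ := max 1 (max (2 * B) (r K / ρ ^ K)) with hM
  have hM0 : 0 < M := zero_lt_one.trans_le (le_max_left _ _)
  have hMB : 2 * B ≤ M := (le_max_left _ _).trans (le_max_right _ _)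
  have hMK : r K / ρ ^ K ≤ M := (le_max_right _ _).trans (le_max_right _ _)
  refine ⟨ρ, hρ0, hρ1, M, hM0, fun k hk => ?_⟩
  induction k, hk using Nat.le_induction with
  | base => exact (div_le_iff₀ (by positivity)).1 hMK
  | succ k hk ih =>
    have h1 := hrec k hk
    have h2 : E (k + 1) ≤ B * ρ ^ k := by
      refine (hE (k + 1)).trans (mul_le_mul_of_nonneg_left ?_ hB)
      calc q ^ (k + 1) ≤ q ^ k := pow_le_pow_of_le_one hq0.le hq1.le (Nat.le_succ k)
        _ ≤ ρ ^ k := pow_le_pow_left₀ hq0.le hqρ k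
    have hρk : 0 < ρ ^ k := by positivity
    have h3 : (1 + C) * r (k + 1) ≤ (C * M + M / 2) * ρ ^ k := by nlinarith
    have h4 : (C * M + M / 2) * ρ ^ k ≤ (1 + C) * (M * ρ ^ (k + 1)) := by
      have : C * M + M / 2 ≤ (1 + C) * M * ρ := by nlinarith
      calc _ ≤ (1 + C) * M * ρ * ρ ^ k := by gcongr
        _ = _ := by ring
    exact le_of_mul_le_mul_left (h3.trans h4) (by linarith)

/-! ### Convergence of sequences with square-controlled steps -/

section Steps

variable {X : Type*} [PseudoMetricSpace X]

lemma exists_tendsto_of_dist_le [CompleteSpace X] {x : ℕ → X} {b : ℕ → ℝ} {K : ℕ}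
    (hb : Tendsto b atTop (𝓝 0)) (h : ∀ k ≥ K, ∀ m ≥ k, dist (x k) (x m) ≤ b k) :
    ∃ xs, Tendsto x atTop (𝓝 xs) ∧ ∀ k ≥ K, dist (x k) xs ≤ b k := by
  have hc : CauchySeq (fun k => x (k + K)) :=
    cauchySeq_of_le_tendsto_0' (fun k => b (k + K)) (fun n m hnm => h _ (by omega) _ (by omega))
      ((tendsto_add_atTop_iff_nat K).2 hb)
  obtain ⟨xs, hxs⟩ := cauchySeq_tendsto_of_complete hc
  have hxs' := (tendsto_add_atTop_iff_nat K).1 hxs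
  refine ⟨xs, hxs', fun k hk => ?_⟩
  refine le_of_tendsto (tendsto_const_nhds.dist hxs') ?_
  filter_upwards [eventually_ge_atTop k] with m hm using h k hk m hm

/-- Cauchy–Schwarz over a block of consecutive steps. -/
lemma dist_sq_le_of_step_sq_le {x : ℕ → X} {r : ℕ → ℝ}
    (hstep : ∀ k, dist (x k) (x (k + 1)) ^ 2 ≤ r k - r (k + 1)) {k m : ℕ} (hkm : k ≤ m) :
    dist (x k) (x m) ^ 2 ≤ ((m : ℝ) - k) * (r k - r m) := by
  have h1 := dist_le_Ico_sum_dist x hkm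
  have h2 : ∑ i ∈ Finset.Ico k m, dist (x i) (x (i + 1)) ^ 2 ≤ r k - r m :=
    (Finset.sum_le_sum fun i _ => hstep i).trans_eq (by
      rw [← neg_sub (r m), ← Finset.sum_Ico_sub r hkm, ← Finset.sum_neg_distrib]
      exact Finset.sum_congr rfl fun i _ => by ring)
  have h3 := sq_sum_le_card_mul_sum_sq (s := Finset.Ico k m) (f := fun i => dist (x i) (x (i + 1)))
  rw [Nat.card_Ico, Nat.cast_sub hkm] at h3
  have h4 : (0 : ℝ) ≤ (m : ℝ) - k := by
    have : (k : ℝ) ≤ m := by exact_mod_cast hkm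
    linarith
  calc _ ≤ (∑ i ∈ Finset.Ico k m, dist (x i) (x (i + 1))) ^ 2 := by gcongr
    _ ≤ _ := h3
    _ ≤ _ := by gcongr

/-- If the squared steps are dominated by the decrements of a nonnegative sequence of order
`k ^ (-p)` with `p > 1`, the sequence converges at the rate `k ^ (-(p - 1) / 2)`: on the block
`[k, 2 k]` Cauchy–Schwarz gives this order, and the dyadic blocks add up geometrically. -/
lemma exists_tendsto_isBigO_rpow_of_step_sq_le [CompleteSpace X] {x : ℕ → X} {r : ℕ → ℝ}
    {p M : ℝ} (hp : 1 < p) (hr0 : ∀ k, 0 ≤ r k)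
    (hstep : ∀ k, dist (x k) (x (k + 1)) ^ 2 ≤ r k - r (k + 1))
    {K : ℕ} (hr : ∀ k ≥ K, r k ≤ M * (k : ℝ) ^ (-p)) :
    ∃ xs, Tendsto x atTop (𝓝 xs) ∧
      (fun k => dist (x k) xs) =O[atTop] (fun k : ℕ => (k : ℝ) ^ (-((p - 1) / 2))) := by
  have hanti : Antitone r := antitone_nat_of_succ_le fun k => by
    linarith [hstep k, sq_nonneg (dist (x k) (x (k + 1)))]
  set β : ℝ := (p - 1) / 2 with hβ
  have hβ0 : 0 < β := by rw [hβ]; linarith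
  set ω : ℝ := 2 ^ (-β) with hω
  have hω0 : 0 < ω := by positivity
  have hω1 : ω < 1 := Real.rpow_lt_one_of_one_lt_of_neg (by norm_num) (by linarith)
  set T : ℝ := √M / (1 - ω) with hT
  have hT1 : T * ω + √M = T := by
    have : 1 - ω ≠ 0 := by linarith
    rw [hT]; field_simp; ring
  have hT0 : 0 ≤ T := div_nonneg (Real.sqrt_nonneg _) (by linarith)
  have hTM : √M ≤ T := by nlinarith
  have hblock : ∀ k ≥ K, 1 ≤ k → ∀ m, k ≤ m → m ≤ 2 * k →
      dist (x k) (x m) ≤ √M * (k : ℝ) ^ (-β) := by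
    intro k hk hk1 m hkm hm
    have hk0 : (0 : ℝ) < k := by exact_mod_cast hk1
    have hm' : (m : ℝ) ≤ 2 * k := by exact_mod_cast hm
    have hkm' : (k : ℝ) ≤ m := by exact_mod_cast hkm
    have hrk := hr k hk
    have hM0 : 0 ≤ M := by
      by_contra hneg
      have := mul_neg_of_neg_of_pos (not_le.1 hneg) (Real.rpow_pos_of_pos hk0 (-p))
      linarith [hr0 k]
    have h1 : dist (x k) (x m) ^ 2 ≤ (√M * (k : ℝ) ^ (-β)) ^ 2 := by
      calc dist (x k) (x m) ^ 2 ≤ ((m : ℝ) - k) * (r k - r m) := dist_sq_le_of_step_sq_le hstep hkm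
        _ ≤ k * (M * (k : ℝ) ^ (-p)) :=
          mul_le_mul (by linarith) (by linarith [hr0 m]) (sub_nonneg.2 (hanti hkm)) hk0.le
        _ = _ := by
          rw [mul_pow, Real.sq_sqrt hM0, ← Real.rpow_natCast, ← Real.rpow_mul hk0.le]
          have : (k : ℝ) * (k : ℝ) ^ (-p) = (k : ℝ) ^ (-β * (2 : ℕ)) := by
            rw [mul_comm, ← Real.rpow_add_one hk0.ne']
            congr 1
            rw [hβ]; push_cast; ring
          rw [← this]; ring
    exact (sq_le_sq₀ dist_nonneg (by positivity)).1 h1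
  have hall : ∀ m k, max K 1 ≤ k → k ≤ m → dist (x k) (x m) ≤ T * (k : ℝ) ^ (-β) := by
    intro m
    suffices ∀ d k, m - k ≤ d → max K 1 ≤ k → k ≤ m → dist (x k) (x m) ≤ T * (k : ℝ) ^ (-β) from
      fun k => this _ k le_rfl
    intro d
    induction d with
    | zero =>
      intro k hd hk hkm
      have : k = m := by omega
      subst this
      simp only [dist_self]
      positivity
    | succ d ih =>
      intro k hd hk hkm
      have hkK : K ≤ k := (le_max_left _ _).trans hk
      have hk1 : 1 ≤ k := (le_max_right _ _).trans hk
      by_cases hm : m ≤ 2 * k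
      · exact (hblock k hkK hk1 m hkm hm).trans (by gcongr)
      · have h1 := hblock k hkK hk1 (2 * k) (by omega) le_rfl
        have h2 := ih (2 * k) (by omega) (by omega) (by omega)
        have h3 : ((2 * k : ℕ) : ℝ) ^ (-β) = ω * (k : ℝ) ^ (-β) := by
          push_cast
          rw [Real.mul_rpow (by norm_num) (by positivity)]
        rw [h3] at h2
        calc _ ≤ _ := dist_triangle _ _ _
          _ ≤ √M * (k : ℝ) ^ (-β) + T * (ω * (k : ℝ) ^ (-β)) := add_le_add h1 h2
          _ = (T * ω + √M) * (k : ℝ) ^ (-β) := by ring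
          _ = _ := by rw [hT1]
  have hlim : Tendsto (fun k : ℕ => T * (k : ℝ) ^ (-β)) atTop (𝓝 0) := by
    simpa using ((tendsto_rpow_neg_atTop hβ0).comp tendsto_natCast_atTop_atTop).const_mul T
  obtain ⟨xs, hxs, hd⟩ := exists_tendsto_of_dist_le hlim (fun k hk m hm => hall m k hk hm)
  refine ⟨xs, hxs, IsBigO.of_bound T ?_⟩
  filter_upwards [eventually_ge_atTop (max K 1)] with k hk
  rw [Real.norm_of_nonneg dist_nonneg, Real.norm_of_nonneg (by positivity)]
  exact hd k hk

/-- The geometric counterpart of `exists_tendsto_isBigO_rpow_of_step_sq_le`. -/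
lemma exists_tendsto_isBigO_pow_of_step_sq_le [CompleteSpace X] {x : ℕ → X} {r : ℕ → ℝ}
    {ρ M : ℝ} (hρ0 : 0 < ρ) (hρ1 : ρ < 1) (hr0 : ∀ k, 0 ≤ r k)
    (hstep : ∀ k, dist (x k) (x (k + 1)) ^ 2 ≤ r k - r (k + 1))
    {K : ℕ} (hr : ∀ k ≥ K, r k ≤ M * ρ ^ k) :
    ∃ xs, Tendsto x atTop (𝓝 xs) ∧ ∃ τ : ℝ, 0 < τ ∧ τ < 1 ∧
      (fun k => dist (x k) xs) =O[atTop] (fun k : ℕ => τ ^ k) := by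
  have hτ0 : 0 < √ρ := Real.sqrt_pos.2 hρ0
  have hτ1 : √ρ < 1 := by rw [Real.sqrt_lt' one_pos]; simpa using hρ1
  have hs : ∀ k, dist (x (k + K)) (x (k + 1 + K)) ≤ √M * √ρ ^ K * √ρ ^ k := by
    intro k
    have h1 := hstep (k + K)
    have h2 := hr (k + K) (by omega)
    have hM : 0 ≤ M := by
      have : 0 ≤ M * ρ ^ (k + K) := (hr0 _).trans h2
      exact nonneg_of_mul_nonneg_left this (by positivity)
    have e : k + 1 + K = k + K + 1 := by omega
    rw [e]
    refine (sq_le_sq₀ dist_nonneg (by positivity)).1 ?_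
    calc _ ≤ r (k + K) - r (k + K + 1) := h1
      _ ≤ M * ρ ^ (k + K) := by linarith [hr0 (k + K + 1)]
      _ = _ := by
        rw [mul_assoc, ← pow_add, mul_pow, Real.sq_sqrt hM, ← pow_mul, mul_comm (K + k) 2, pow_mul,
          Real.sq_sqrt hρ0.le, add_comm]
  have hc := cauchySeq_of_le_geometric (f := fun k => x (k + K)) _ _ hτ1 hs
  obtain ⟨xs, hxs⟩ := cauchySeq_tendsto_of_complete hc
  refine ⟨xs, (tendsto_add_atTop_iff_nat K).1 hxs, √ρ, hτ0, hτ1,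
    IsBigO.of_bound (√M / (1 - √ρ)) ?_⟩
  filter_upwards [eventually_ge_atTop K] with k hk
  have h := dist_le_of_le_geometric_of_tendsto _ _ hτ1 hs hxs (k - K)
  rw [Nat.sub_add_cancel hk] at h
  rw [Real.norm_of_nonneg dist_nonneg, Real.norm_of_nonneg (by positivity)]
  refine h.trans_eq ?_
  rw [mul_assoc, ← pow_add, Nat.add_sub_of_le hk]
  ring

end Steps

/-! ### Smooth functions, convex subgradients and metrics -/

section Smooth

variable {V : Type*} [NormedAddCommGroup V] [InnerProductSpace ℝ V] [CompleteSpace V]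

/-- The quadratic upper bound for a function with `L`-Lipschitz gradient. -/
lemma le_add_inner_add_sq_of_gradient_lipschitz {h : V → ℝ} {L : ℝ} (hd : Differentiable ℝ h)
    (hL : ∀ x y, ‖gradient h x - gradient h y‖ ≤ L * ‖x - y‖) (x y : V) :
    h y ≤ h x + inner ℝ (gradient h x) (y - x) + L / 2 * ‖y - x‖ ^ 2 := by
  set s := y - x with hs
  set φ : ℝ → ℝ := fun t => h (x + t • s) - t * inner ℝ (gradient h x) s - L / 2 * t ^ 2 * ‖s‖ ^ 2
    with hφ
  have hder : ∀ t, HasDerivAt φ (inner ℝ (gradient h (x + t • s)) s - inner ℝ (gradient h x) s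
      - L * t * ‖s‖ ^ 2) t := by
    intro t
    have h1 : HasDerivAt (fun t : ℝ => x + t • s) s t := by
      simpa using ((hasDerivAt_id t).smul_const s).const_add x
    have h2 := ((hd (x + t • s)).hasGradientAt.hasFDerivAt).comp_hasDerivAt t h1
    simp only [InnerProductSpace.toDual_apply_apply] at h2
    have h3 := (hasDerivAt_id t).mul_const (inner ℝ (gradient h x) s)
    have h4 := ((hasDerivAt_pow 2 t).const_mul (L / 2)).mul_const (‖s‖ ^ 2)
    refine ((h2.sub h3).sub h4).congr_deriv ?_
    push_cast
    ring
  have hanti : AntitoneOn φ (Set.Icc 0 1) := by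
    refine antitoneOn_of_deriv_nonpos (convex_Icc 0 1)
      (fun t _ => (hder t).continuousAt.continuousWithinAt)
      (fun t _ => (hder t).differentiableAt.differentiableWithinAt) fun t ht => ?_
    rw [interior_Icc] at ht
    rw [(hder t).deriv, ← inner_sub_left]
    have h1 := real_inner_le_norm (gradient h (x + t • s) - gradient h x) s
    have h2 := hL (x + t • s) x
    rw [add_sub_cancel_left, norm_smul, Real.norm_of_nonneg ht.1.le] at h2
    nlinarith [norm_nonneg s]
  have := hanti (Set.left_mem_Icc.2 zero_le_one) (Set.right_mem_Icc.2 zero_le_one) zero_le_one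
  simp only [hφ, one_smul, zero_smul, add_zero, hs, add_sub_cancel] at this
  linarith

end Smooth

variable {n : ℕ}

lemma coe_toReal_of_mem_effDom {φ : Rn n → EReal} (hφ : IsProperFun φ) {x : Rn n}
    (hx : x ∈ effDom φ) : ((φ x).toReal : EReal) = φ x :=
  EReal.coe_toReal (ne_of_lt hx) (hφ.1 x)

lemma epsSubdiff_toReal_le {φ : Rn n → EReal} (hφ : IsProperFun φ) {x z d : Rn n} {δ : ℝ}
    (hd : d ∈ epsSubdiff δ φ x) (hz : z ∈ effDom φ) :
    (φ x).toReal + (inner ℝ d (z - x) - δ) ≤ (φ z).toReal := by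
  have h := hd.2 z
  rw [← coe_toReal_of_mem_effDom hφ hz, ← coe_toReal_of_mem_effDom hφ hd.1, ← EReal.coe_add,
    EReal.coe_le_coe_iff] at h
  exact h

/-- At a point of differentiability the only convex subgradient is the gradient. -/
lemma eq_gradient_of_mem_epsSubdiff_zero {g : Rn n → ℝ} {x d : Rn n}
    (hg : DifferentiableAt ℝ g x) (hd : d ∈ epsSubdiff 0 (fun z => (g z : EReal)) x) :
    d = gradient g x := by
  have hmin : IsLocalMin (fun z => g z - inner ℝ d z) x := by
    refine Eventually.of_forall fun z => ?_
    have h := hd.2 z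
    rw [← EReal.coe_add, EReal.coe_le_coe_iff, inner_sub_right] at h
    simp only
    linarith
  have h1 : HasFDerivAt (fun z => g z - inner ℝ d z)
      (InnerProductSpace.toDual ℝ _ (gradient g x) - InnerProductSpace.toDual ℝ _ d) x :=
    hg.hasGradientAt.hasFDerivAt.sub (InnerProductSpace.toDual ℝ (Rn n) d).hasFDerivAt
  have h2 := hmin.hasFDerivAt_eq_zero h1
  rw [← map_sub, LinearIsometryEquiv.map_eq_zero_iff, sub_eq_zero] at h2
  exact h2.symm

lemma inner_toEuclideanLin_nonneg {A : Matrix (Fin n) (Fin n) ℝ} (hA : A.PosSemidef) (s : Rn n) :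
    0 ≤ inner ℝ (Matrix.toEuclideanLin A s) s :=
  (Matrix.isPositive_toEuclideanLin_iff.2 hA).inner_nonneg_left s

lemma toEuclideanLin_smul_one (c : ℝ) (s : Rn n) :
    Matrix.toEuclideanLin (c • (1 : Matrix (Fin n) (Fin n) ℝ)) s = c • s := by
  simp

lemma le_inner_toEuclideanLin {A : Matrix (Fin n) (Fin n) ℝ} {c : ℝ}
    (hA : (A - c • (1 : Matrix (Fin n) (Fin n) ℝ)).PosSemidef) (s : Rn n) :
    c * ‖s‖ ^ 2 ≤ inner ℝ (Matrix.toEuclideanLin A s) s := by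
  have h := inner_toEuclideanLin_nonneg hA s
  rw [map_sub, LinearMap.sub_apply, toEuclideanLin_smul_one, inner_sub_left, inner_smul_left,
    real_inner_self_eq_norm_sq] at h
  simpa using h

lemma inner_toEuclideanLin_le {A : Matrix (Fin n) (Fin n) ℝ} {c : ℝ}
    (hA : (c • (1 : Matrix (Fin n) (Fin n) ℝ) - A).PosSemidef) (s : Rn n) :
    inner ℝ (Matrix.toEuclideanLin A s) s ≤ c * ‖s‖ ^ 2 := by
  have h := inner_toEuclideanLin_nonneg hA s
  rw [map_sub, LinearMap.sub_apply, toEuclideanLin_smul_one, inner_sub_left, inner_smul_left,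
    real_inner_self_eq_norm_sq] at h
  simpa using h

/-- A positive semidefinite `A ⪯ c I` has operator norm at most `c`: expand
`0 ≤ ⟪A (c s - A s), c s - A s⟫`. -/
lemma norm_toEuclideanLin_le {A : Matrix (Fin n) (Fin n) ℝ} {c : ℝ} (hc : 0 < c)
    (hA : A.PosSemidef) (hAc : (c • (1 : Matrix (Fin n) (Fin n) ℝ) - A).PosSemidef) (s : Rn n) :
    ‖Matrix.toEuclideanLin A s‖ ≤ c * ‖s‖ := by
  set T := Matrix.toEuclideanLin A with hT
  have h0 := inner_toEuclideanLin_nonneg hA (c • s - T s)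
  have h1 := inner_toEuclideanLin_le hAc s
  have h2 := inner_toEuclideanLin_le hAc (T s)
  have hsym : inner ℝ (T (T s)) s = inner ℝ (T s) (T s) :=
    (Matrix.isPositive_toEuclideanLin_iff.2 hA).isSymmetric (T s) s
  rw [← hT] at h0 h1 h2
  simp only [map_sub, map_smul, inner_sub_left, inner_sub_right, inner_smul_left, inner_smul_right,
    hsym, real_inner_self_eq_norm_sq, RCLike.conj_to_real] at h0
  have h3 : c * ‖T s‖ ^ 2 ≤ c * (c * ‖s‖) ^ 2 := by nlinarith [sq_pos_of_pos hc]
  exact (sq_le_sq₀ (norm_nonneg _) (by positivity)).1 (le_of_mul_le_mul_left h3 hc)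

/-! ### Subgradients of the ratio -/

lemma fracObj_of_mem {f : Rn n → EReal} {h g : Rn n → ℝ} {x : Rn n}
    (hx : x ∈ effDom f ∩ denomSet g) : fracObj f h g x = (ratio f h g x : EReal) :=
  if_pos hx

lemma fracObj_of_notMem {f : Rn n → EReal} {h g : Rn n → ℝ} {x : Rn n}
    (hx : x ∉ effDom f ∩ denomSet g) : fracObj f h g x = ⊤ :=
  if_neg hx

/-- Membership in the regular subdifferential of the ratio, checked on finite values only. -/
lemma mem_regSubdiff_fracObj {f : Rn n → EReal} {h g : Rn n → ℝ} {x v : Rn n}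
    (hx : x ∈ effDom f ∩ denomSet g)
    (hv : ∀ η > (0 : ℝ), ∀ᶠ y in 𝓝 x, y ∈ effDom f ∩ denomSet g →
      -η * ‖y - x‖ ≤ ratio f h g y - ratio f h g x - inner ℝ v (y - x)) :
    v ∈ regSubdiff (fracObj f h g) x := by
  have hFx := fracObj_of_mem (h := h) hx
  refine ⟨by simp [hFx], by simp [hFx], le_of_forall_lt fun b hb => ?_⟩
  obtain ⟨t, hbt, ht0⟩ := EReal.lt_iff_exists_real_btwn.1 hb
  have ht : 0 < -t := by
    have : t < 0 := by exact_mod_cast ht0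
    linarith
  refine hbt.trans_le (le_liminf_of_le (by isBoundedDefault) ?_)
  filter_upwards [(hv _ ht).filter_mono nhdsWithin_le_nhds, self_mem_nhdsWithin] with y hy hyx
  have hpos : 0 < ‖y - x‖ := norm_pos_iff.2 (sub_ne_zero.2 hyx)
  by_cases hym : y ∈ effDom f ∩ denomSet g
  · have h1 := hy hym
    rw [hFx, fracObj_of_mem hym, ← EReal.coe_sub, ← EReal.coe_sub, ← EReal.coe_div,
      EReal.coe_le_coe_iff, le_div_iff₀ hpos]
    linarith
  · rw [hFx, fracObj_of_notMem hym, EReal.top_sub_coe, EReal.top_sub_coe,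
      EReal.top_div_of_pos_ne_top (by exact_mod_cast hpos) (EReal.coe_ne_top _)]
    exact le_top

/-- The quotient rule for regular subgradients: it needs a convex subgradient of `f` only. -/
lemma smul_mem_regSubdiff_fracObj {f : Rn n → EReal} {h g : Rn n → ℝ} {L : ℝ}
    (hA : BasicAssumptions f h g L) {x d : Rn n} (hx : x ∈ effDom f ∩ denomSet g)
    (hd : d ∈ epsSubdiff 0 f x) (hg : DifferentiableAt ℝ g x) :
    (g x)⁻¹ • (d + gradient h x - ratio f h g x • gradient g x)
      ∈ regSubdiff (fracObj f h g) x := by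
  set R := ratio f h g x with hR
  set w := d + gradient h x - R • gradient g x with hw
  have hgx : 0 < g x := hA.g_pos x hx
  have hho := hasGradientAt_iff_isLittleO.1
    ((hA.h_contDiff.differentiable one_ne_zero) x).hasGradientAt
  have hgo := hasGradientAt_iff_isLittleO.1 hg.hasGradientAt
  have hcinv : ContinuousAt (fun y => (g y)⁻¹) x := hA.g_continuous.continuousAt.inv₀ hgx.ne'
  have hρ : (fun y => (h y - h x - inner ℝ (gradient h x) (y - x))
      - R * (g y - g x - inner ℝ (gradient g x) (y - x))) =o[𝓝 x] fun y => y - x :=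
    hho.sub (hgo.const_mul_left R)
  have h1 : (fun y => (g y)⁻¹ * ((h y - h x - inner ℝ (gradient h x) (y - x))
      - R * (g y - g x - inner ℝ (gradient g x) (y - x)))) =o[𝓝 x] fun y => y - x := by
    have := (hcinv.isBigO_one ℝ).mul_isLittleO hρ.norm_right
    simpa using this
  have h2 : (fun y => ((g y)⁻¹ - (g x)⁻¹) * inner ℝ w (y - x)) =o[𝓝 x] fun y => y - x := by
    have hz : (fun y => (g y)⁻¹ - (g x)⁻¹) =o[𝓝 x] fun _ => (1 : ℝ) := by
      rw [isLittleO_one_iff]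
      simpa using hcinv.tendsto.sub_const (g x)⁻¹
    have hb : (fun y => inner ℝ w (y - x)) =O[𝓝 x] fun y => ‖y - x‖ :=
      IsBigO.of_bound ‖w‖ (Eventually.of_forall fun y => by
        rw [norm_norm]; exact norm_inner_le_norm w (y - x))
    have := hz.mul_isBigO hb
    simpa using this
  have h3 := h1.add h2
  refine mem_regSubdiff_fracObj hx fun η hη => ?_
  filter_upwards [h3.def hη] with y hy hym
  have hgy : 0 < g y := hA.g_pos y hym
  have hsub := epsSubdiff_toReal_le hA.f_proper hd hym.1
  have hNx : (f x).toReal + h x = R * g x := by rw [hR, ratio, div_mul_cancel₀ _ hgx.ne']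
  have hlow := (abs_le.1 (Real.norm_eq_abs _ ▸ hy)).1
  have hkey : (g y)⁻¹ * (inner ℝ w (y - x) + ((h y - h x - inner ℝ (gradient h x) (y - x))
      - R * (g y - g x - inner ℝ (gradient g x) (y - x)))) ≤ ratio f h g y - R := by
    have e : ratio f h g y - R = (g y)⁻¹ * ((f y).toReal + h y - R * g y) := by
      rw [ratio]; field_simp
    rw [e]
    refine mul_le_mul_of_nonneg_left ?_ (inv_nonneg.2 hgy.le)
    rw [hw, inner_sub_left, inner_add_left, inner_smul_left]
    simp only [RCLike.conj_to_real]
    linarith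
  rw [inner_smul_left]
  simp only [RCLike.conj_to_real]
  linarith

lemma regSubdiff_subset_limSubdiff (φ : Rn n → EReal) (x : Rn n) :
    regSubdiff φ x ⊆ limSubdiff φ x := fun d hd =>
  ⟨hd.1, hd.2.1, fun _ => x, fun _ => d, tendsto_const_nhds, tendsto_const_nhds,
    tendsto_const_nhds, fun _ => hd⟩

/-! ### Sublevel sets of the ratio -/

lemma BasicAssumptions.isCompact_sublevel {f : Rn n → EReal} {h g : Rn n → ℝ} {L : ℝ}
    (hA : BasicAssumptions f h g L) (α : ℝ) :
    IsCompact {x | x ∈ effDom f ∩ denomSet g ∧ ratio f h g x ≤ α} := by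
  -- Clearing the denominator turns the sublevel set into a closed set: points with `g x = 0` are
  -- excluded by the positivity of the numerator there.
  have hS : {x | x ∈ effDom f ∩ denomSet g ∧ ratio f h g x ≤ α}
      = {x | f x ≤ ((α * g x - h x : ℝ) : EReal)} ∩ {x | 0 ≤ g x} := by
    ext x
    simp only [Set.mem_ofPred_eq, Set.mem_inter_iff]
    constructor
    · rintro ⟨hx, hr⟩
      have hgx := hA.g_pos x hx
      rw [ratio, div_le_iff₀ hgx] at hr
      refine ⟨?_, hgx.le⟩
      rw [← coe_toReal_of_mem_effDom hA.f_proper hx.1, EReal.coe_le_coe_iff]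
      linarith
    · rintro ⟨hf, hg0⟩
      have hdom : x ∈ effDom f := hf.trans_lt (EReal.coe_lt_top _)
      rw [← coe_toReal_of_mem_effDom hA.f_proper hdom, EReal.coe_le_coe_iff] at hf
      have hgne : g x ≠ 0 := by
        intro h0
        have := hA.num_pos x h0
        rw [← coe_toReal_of_mem_effDom hA.f_proper hdom, ← EReal.coe_add] at this
        have h1 : 0 < (f x).toReal + h x := by exact_mod_cast this
        rw [h0] at hf
        linarith
      refine ⟨⟨hdom, hgne⟩, ?_⟩
      rw [ratio, div_le_iff₀ (lt_of_le_of_ne hg0 hgne.symm)]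
      linarith
  have hcl : IsClosed {x | x ∈ effDom f ∩ denomSet g ∧ ratio f h g x ≤ α} := by
    rw [hS]
    refine IsClosed.inter ?_ (isClosed_le continuous_const hA.g_continuous)
    have hcont : Continuous fun x : Rn n => (x, ((α * g x - h x : ℝ) : EReal)) :=
      continuous_id.prodMk (continuous_coe_real_ereal.comp
        ((continuous_const.mul hA.g_continuous).sub hA.h_contDiff.continuous))
    exact hA.f_closed.isClosed_epigraph.preimage hcont
  refine Metric.isCompact_of_isClosed_isBounded hcl ((hA.level_bounded α).subset ?_)
  rintro x ⟨hx, hr⟩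
  rw [Set.mem_ofPred_eq, fracObj_of_mem hx]
  exact_mod_cast hr

lemma BasicAssumptions.ratio_nonneg {f : Rn n → EReal} {h g : Rn n → ℝ} {L : ℝ}
    (hA : BasicAssumptions f h g L) {x : Rn n} (hx : x ∈ effDom f ∩ denomSet g) :
    0 ≤ ratio f h g x := by
  have h1 := hA.num_nonneg x hx.1
  rw [← coe_toReal_of_mem_effDom hA.f_proper hx.1, ← EReal.coe_add] at h1
  have h2 : 0 ≤ (f x).toReal + h x := by exact_mod_cast h1
  exact div_nonneg h2 (hA.g_pos x hx).le

lemma isOpen_denomSet {g : Rn n → ℝ} (hg : Continuous g) : IsOpen (denomSet g) :=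
  isOpen_ne_fun hg continuous_const

lemma BasicAssumptions.continuousOn_ratio {f : Rn n → EReal} {h g : Rn n → ℝ} {L : ℝ}
    (hA : BasicAssumptions f h g L)
    (hB : LocallyLipschitzOn (effDom f) (fun x => (f x).toReal)) :
    ContinuousOn (ratio f h g) (effDom f ∩ denomSet g) :=
  ((hB.continuousOn.mono Set.inter_subset_left).add hA.h_contDiff.continuous.continuousOn).div
    hA.g_continuous.continuousOn fun _ hx => hx.2

/-- On a sublevel set, the denominator is bounded away from `0`. -/
lemma BasicAssumptions.exists_pos_le_denom {f : Rn n → EReal} {h g : Rn n → ℝ} {L : ℝ}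
    (hA : BasicAssumptions f h g L) (α : ℝ) :
    ∃ m > 0, ∀ x ∈ effDom f ∩ denomSet g, ratio f h g x ≤ α → m ≤ g x := by
  obtain ⟨m, hm, hle⟩ := (hA.isCompact_sublevel α).exists_forall_le' hA.g_continuous.continuousOn
    (a := 0) fun x hx => hA.g_pos x hx.1
  exact ⟨m, hm, fun x hx hr => hle x ⟨hx, hr⟩⟩

/-- On a sublevel set, the ratio and the gradient of the denominator are Lipschitz. -/
lemma BasicAssumptions.exists_lipschitz_sublevel {f : Rn n → EReal} {h g : Rn n → ℝ} {L : ℝ}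
    (hA : BasicAssumptions f h g L)
    (hB : LocallyLipschitzOn (effDom f) (fun x => (f x).toReal))
    (hC : LocallyLipschitzOn (denomSet g) (gradient g)) (α : ℝ) :
    ∃ C ≥ 0, ∀ x ∈ effDom f ∩ denomSet g, ratio f h g x ≤ α →
      ∀ y ∈ effDom f ∩ denomSet g, ratio f h g y ≤ α →
        |ratio f h g x - ratio f h g y| ≤ C * ‖x - y‖ ∧
        ‖gradient g x - gradient g y‖ ≤ C * ‖x - y‖ := by
  set S := {x | x ∈ effDom f ∩ denomSet g ∧ ratio f h g x ≤ α} with hSdef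
  have hS : IsCompact S := hA.isCompact_sublevel α
  obtain ⟨m, hm, hgm⟩ := hA.exists_pos_le_denom α
  obtain ⟨Kf, hKf⟩ := (hB.mono (fun x (hx : x ∈ S) => hx.1.1)).exists_lipschitzOnWith_of_compact hS
  obtain ⟨Kh, hKh⟩ := ((hA.h_contDiff.locallyLipschitz).locallyLipschitzOn
    (s := S)).exists_lipschitzOnWith_of_compact hS
  obtain ⟨Kg, hKg⟩ := (hA.g_convex.locallyLipschitz.locallyLipschitzOn
    (s := S)).exists_lipschitzOnWith_of_compact hS
  obtain ⟨Kd, hKd⟩ := (hC.mono (fun x (hx : x ∈ S) => hx.1.2)).exists_lipschitzOnWith_of_compact hS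
  refine ⟨max ((Kf + Kh + α * Kg) / m) Kd, le_max_of_le_right Kd.2, fun x hx hxα y hy hyα => ?_⟩
  have hxS : x ∈ S := ⟨hx, hxα⟩
  have hyS : y ∈ S := ⟨hy, hyα⟩
  have h1 := hKf.dist_le_mul x hxS y hyS
  have h2 := hKh.dist_le_mul x hxS y hyS
  have h3 := hKg.dist_le_mul x hxS y hyS
  have h4 := hKd.dist_le_mul x hxS y hyS
  rw [Real.dist_eq, dist_eq_norm] at h1 h2 h3
  rw [dist_eq_norm, dist_eq_norm] at h4
  refine ⟨?_, h4.trans (mul_le_mul_of_nonneg_right (le_max_right _ _) (norm_nonneg _))⟩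
  refine le_trans ?_ (mul_le_mul_of_nonneg_right (le_max_left _ _) (norm_nonneg _))
  have hgx := hA.g_pos x hx
  have hgy := hA.g_pos y hy
  have e : ratio f h g x - ratio f h g y = (((f x).toReal - (f y).toReal) + (h x - h y)
      - ratio f h g y * (g x - g y)) / g x := by
    have : ratio f h g y * g y = (f y).toReal + h y := by rw [ratio, div_mul_cancel₀ _ hgy.ne']
    rw [eq_div_iff hgx.ne', sub_mul, ratio, div_mul_cancel₀ _ hgx.ne']
    linarith
  rw [e, abs_div, abs_of_pos hgx, div_mul_eq_mul_div, div_le_div_iff₀ hgx hm]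
  have h5 : |ratio f h g y * (g x - g y)| ≤ α * (Kg * ‖x - y‖) := by
    rw [abs_mul, abs_of_nonneg (hA.ratio_nonneg hy)]
    exact mul_le_mul hyα h3 (abs_nonneg _) ((hA.ratio_nonneg hy).trans hyα)
  have h6 := abs_sub (((f x).toReal - (f y).toReal) + (h x - h y)) (ratio f h g y * (g x - g y))
  have h7 := abs_add_le ((f x).toReal - (f y).toReal) (h x - h y)
  have h8 : |((f x).toReal - (f y).toReal) + (h x - h y) - ratio f h g y * (g x - g y)|
      ≤ (Kf + Kh + α * Kg) * ‖x - y‖ := by linarith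
  exact mul_le_mul h8 (hgm x hx hxα) hm.le ((abs_nonneg _).trans h8)

/-! ### The Kurdyka–Łojasiewicz inequality along a sequence -/

/-- Along a sequence in a compact set with subgradients tending to `0` and converging values, the
KL inequality holds with one constant, without knowing that the sequence converges: otherwise it
would fail along a subsequence converging to a point where `0` is a limiting subgradient. The
exponent may be enlarged, since the gaps are eventually at most `1`. -/
lemma IsKLFunctionWithExponent.eventually_mul_rpow_le {φ : Rn n → EReal} {θ θ' : ℝ}
    (hKL : IsKLFunctionWithExponent φ θ) (hθ : θ ≤ θ') {S : Set (Rn n)} (hS : IsCompact S)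
    {R : Rn n → ℝ} (hR : ContinuousOn R S) (hφ : ∀ z ∈ S, φ z = (R z : EReal))
    {u v : ℕ → Rn n} (hu : ∀ k, u k ∈ S) (hv : ∀ k, v k ∈ regSubdiff φ (u k))
    (hv0 : Tendsto v atTop (𝓝 0)) {c : ℝ} (hc : Tendsto (fun k => R (u k)) atTop (𝓝 c)) :
    ∃ A > 0, ∀ᶠ k in atTop, c < R (u k) → A * (R (u k) - c) ^ θ' ≤ ‖v k‖ := by
  by_contra! hcon
  have hfreq : ∀ j : ℕ, ∃ᶠ k in atTop,
      c < R (u k) ∧ ‖v k‖ < 1 / ((j : ℝ) + 1) * (R (u k) - c) ^ θ' :=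
    fun j => hcon _ (by positivity)
  obtain ⟨ψ, hψ, hP⟩ := extraction_forall_of_frequently hfreq
  obtain ⟨z, hzS, σ, hσ, hz⟩ := hS.tendsto_subseq fun j => hu (ψ j)
  have hκ : Tendsto (fun j => ψ (σ j)) atTop atTop := (hψ.comp hσ).tendsto_atTop
  have hzw : Tendsto (fun j => u (ψ (σ j))) atTop (𝓝[S] z) :=
    tendsto_nhdsWithin_iff.2 ⟨hz, Eventually.of_forall fun j => hu _⟩
  have hRz : R z = c := tendsto_nhds_unique ((hR z hzS).tendsto.comp hzw) (hc.comp hκ)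
  have hzero : (0 : Rn n) ∈ limSubdiff φ z := by
    refine ⟨by simp [hφ z hzS], by simp [hφ z hzS], fun j => u (ψ (σ j)), fun j => v (ψ (σ j)), hz,
      ?_, hv0.comp hκ, fun j => hv _⟩
    simp only [hφ _ (hu _), hφ z hzS, hRz]
    exact (continuous_coe_real_ereal.tendsto c).comp (hc.comp hκ)
  obtain ⟨a, ha, μ, hμ, ν, hν, hineq⟩ := hKL z ⟨0, hzero⟩
  have e1 : ∀ᶠ j in atTop, ‖u (ψ (σ j)) - z‖ < μ := by
    have := tendsto_iff_norm_sub_tendsto_zero.1 hz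
    exact this.eventually_lt_const hμ
  have e2 : ∀ᶠ j in atTop, R (u (ψ (σ j))) < c + min ν 1 :=
    (hc.comp hκ).eventually_lt_const (by linarith [lt_min hν one_pos])
  have e3 : ∀ᶠ j in atTop, 1 / ((σ j : ℝ) + 1) < a :=
    (tendsto_one_div_add_atTop_nhds_zero_nat.comp hσ.tendsto_atTop).eventually_lt_const ha
  obtain ⟨j, h1, h2, h3⟩ := (e1.and (e2.and e3)).exists
  obtain ⟨hlt, hvlt⟩ := hP (σ j)
  set k := ψ (σ j)
  have hpos : 0 < R (u k) - c := sub_pos.2 hlt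
  have h4 : a * (R (u k) - c) ^ θ ≤ Metric.infDist 0 (limSubdiff φ (u k)) := by
    have := hineq (u k) ⟨v k, regSubdiff_subset_limSubdiff _ _ (hv k)⟩ h1.le
      (by rw [hφ _ (hu k), hφ z hzS, hRz]; exact_mod_cast hlt)
      (by
        rw [hφ _ (hu k), hφ z hzS, hRz, ← EReal.coe_add, EReal.coe_lt_coe_iff]
        linarith [min_le_left ν 1])
    rwa [hφ _ (hu k), hφ z hzS, hRz, EReal.toReal_coe, EReal.toReal_coe] at this
  have h5 : Metric.infDist 0 (limSubdiff φ (u k)) ≤ ‖v k‖ := by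
    have := Metric.infDist_le_dist_of_mem (x := (0 : Rn n))
      (regSubdiff_subset_limSubdiff _ _ (hv k))
    rwa [dist_zero_left] at this
  have h6 : (R (u k) - c) ^ θ' ≤ (R (u k) - c) ^ θ :=
    Real.rpow_le_rpow_of_exponent_ge hpos (by linarith [min_le_right ν 1]) hθ
  have h7 : 1 / ((σ j : ℝ) + 1) * (R (u k) - c) ^ θ' ≤ a * (R (u k) - c) ^ θ :=
    mul_le_mul h3.le h6 (Real.rpow_nonneg hpos.le _) ha.le
  linarith

/-! ### One iteration of the algorithm -/

section Iteration

variable {f : Rn n → EReal} {h g : Rn n → ℝ} {L : ℝ} {ε : ℕ → ℝ}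
  {H : ℕ → Matrix (Fin n) (Fin n) ℝ} {x y Δ : ℕ → Rn n} {δ : ℕ → ℝ}

/-- Sufficient decrease of the ratio, up to the tolerance. -/
lemma IsIVPGSASequence.sufficient_decrease (hx : IsIVPGSASequence f h g ε H x y Δ δ)
    (hA : BasicAssumptions f h g L) {γ : ℝ}
    (hH : ∀ k, (H k - γ • (1 : Matrix (Fin n) (Fin n) ℝ)).PosSemidef) (k : ℕ) :
    (γ - L / 2) * ‖x (k + 1) - x k‖ ^ 2 + ‖Δ k‖ ^ 2
      ≤ g (x (k + 1)) * (ratio f h g (x k) + ε k - ratio f h g (x (k + 1))) := by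
  obtain ⟨d, hd, hΔ⟩ := hx.inexact k
  set s := x (k + 1) - x k with hs
  have hf := epsSubdiff_toReal_le hA.f_proper hd (hx.mem_dom k).1
  have hh := le_add_inner_add_sq_of_gradient_lipschitz
    (hA.h_contDiff.differentiable one_ne_zero) hA.grad_lipschitz (x k) (x (k + 1))
  have hg : g (x k) + inner ℝ (y k) s ≤ g (x (k + 1)) := by
    have := (hx.subgrad k).2 (x (k + 1))
    rw [← EReal.coe_add, EReal.coe_le_coe_iff, sub_zero] at this
    exact this
  have hmet := le_inner_toEuclideanLin (hH k) s
  have hcrit := hx.criterion k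
  have hgk := hA.g_pos _ (hx.mem_dom k)
  have hgk1 := hA.g_pos _ (hx.mem_dom (k + 1))
  have hc := hA.ratio_nonneg (hx.mem_dom k)
  have hNk : ratio f h g (x k) * g (x k) = (f (x k)).toReal + h (x k) := by
    rw [ratio, div_mul_cancel₀ _ hgk.ne']
  have hNk1 : ratio f h g (x (k + 1)) * g (x (k + 1))
      = (f (x (k + 1))).toReal + h (x (k + 1)) := by
    rw [ratio, div_mul_cancel₀ _ hgk1.ne']
  have hin : inner ℝ (Δ k) s = inner ℝ d s + inner ℝ (gradient h (x k)) s
      - ratio f h g (x k) * inner ℝ (y k) s + inner ℝ (Matrix.toEuclideanLin (H k) s) s := by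
    rw [hΔ, inner_add_left, inner_sub_left, inner_add_left, inner_smul_left]
    simp only [RCLike.conj_to_real]
  have hneg : inner ℝ d (x k - x (k + 1)) = - inner ℝ d s := by
    rw [hs, ← inner_neg_right, neg_sub]
  have habs := le_abs_self (inner ℝ (Δ k) s)
  have hcg := mul_le_mul_of_nonneg_left hg hc
  rw [hneg] at hf
  rw [← hs] at hh
  nlinarith

/-- An exact inner step (`δ k = 0`) yields an explicit subgradient of the ratio. -/
lemma IsIVPGSASequence.exists_mem_regSubdiff (hx : IsIVPGSASequence f h g ε H x y Δ δ)
    (hA : BasicAssumptions f h g L) (hC : ContDiffOn ℝ 1 g (denomSet g)) {γ : ℝ} (hγ : 0 < γ)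
    (hH : ∀ k, (γ • (1 : Matrix (Fin n) (Fin n) ℝ) - H k).PosSemidef) {k : ℕ} (hδ : δ k = 0) :
    ∃ v ∈ regSubdiff (fracObj f h g) (x (k + 1)), ‖v‖ ≤ (g (x (k + 1)))⁻¹ *
      (‖Δ k‖ + (L + γ) * ‖x (k + 1) - x k‖
        + ratio f h g (x k) * ‖gradient g (x k) - gradient g (x (k + 1))‖
        + |ratio f h g (x k) - ratio f h g (x (k + 1))| * ‖gradient g (x (k + 1))‖) := by
  have hdiff : ∀ j, DifferentiableAt ℝ g (x j) := fun j =>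
    (hC.differentiableOn one_ne_zero).differentiableAt
      ((isOpen_denomSet hA.g_continuous).mem_nhds (hx.mem_dom j).2)
  obtain ⟨d, hd, hΔ⟩ := hx.inexact k
  rw [hδ] at hd
  rw [eq_gradient_of_mem_epsSubdiff_zero (hdiff k) (hx.subgrad k)] at hΔ
  refine ⟨_, smul_mem_regSubdiff_fracObj hA (hx.mem_dom (k + 1)) hd (hdiff (k + 1)), ?_⟩
  have hgk1 := hA.g_pos _ (hx.mem_dom (k + 1))
  rw [norm_smul, Real.norm_of_nonneg (inv_nonneg.2 hgk1.le)]
  refine mul_le_mul_of_nonneg_left ?_ (inv_nonneg.2 hgk1.le)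
  set s := x (k + 1) - x k with hs
  set c := ratio f h g (x k)
  set c' := ratio f h g (x (k + 1))
  have e : d + gradient h (x (k + 1)) - c' • gradient g (x (k + 1))
      = Δ k + (gradient h (x (k + 1)) - gradient h (x k)) - Matrix.toEuclideanLin (H k) s
        + c • (gradient g (x k) - gradient g (x (k + 1)))
        + (c - c') • gradient g (x (k + 1)) := by
    rw [hΔ]; module
  have h1 := hA.grad_lipschitz (x (k + 1)) (x k)
  have h2 := norm_toEuclideanLin_le hγ (hx.metric_posDef k).posSemidef (hH k) s
  have hc : 0 ≤ c := hA.ratio_nonneg (hx.mem_dom k)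
  rw [e]
  calc _ ≤ ‖Δ k‖ + ‖gradient h (x (k + 1)) - gradient h (x k)‖ + ‖Matrix.toEuclideanLin (H k) s‖
        + ‖c • (gradient g (x k) - gradient g (x (k + 1)))‖
        + ‖(c - c') • gradient g (x (k + 1))‖ := by
        refine (norm_add_le _ _).trans (add_le_add_left ((norm_add_le _ _).trans
          (add_le_add_left ((norm_sub_le _ _).trans (add_le_add_left (norm_add_le _ _) _)) _)) _)
    _ ≤ _ := by
        rw [norm_smul, norm_smul, Real.norm_of_nonneg hc, Real.norm_eq_abs]
        linarith

end Iteration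

/-! ### The error-corrected gap and its consequences -/

/-- `r` is a Lyapunov sequence for `x` with error tail `E`: its decrements dominate the squared
steps and also, through any KL exponent `θ' ≥ θ`, a power of `r - E`. In the application `r k` is
the gap of the objective to its limit plus `E k`. -/
structure IsKLLyapunov (x : ℕ → Rn n) (E r : ℕ → ℝ) (θ : ℝ) : Prop where
  nonneg : ∀ k, 0 ≤ r k
  step : ∃ A > 0, ∀ k, dist (x k) (x (k + 1)) ^ 2 ≤ A * (r k - r (k + 1))
  kl : ∀ θ' ≥ θ, ∃ C > 0, ∃ K : ℕ, ∀ k ≥ K, E (k + 1) < r (k + 1) →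
    (r (k + 1) - E (k + 1)) ^ (2 * θ') ≤ C * (r k - r (k + 1))

lemma IsKLLyapunov.exists_tendsto_isBigO_rpow {x : ℕ → Rn n} {E r : ℕ → ℝ} {θ p : ℝ}
    (hr : IsKLLyapunov x E r θ) (hp : 1 < p) (hθ : θ ≤ (p + 1) / (2 * p))
    (hE : E =O[atTop] fun k : ℕ => (k : ℝ) ^ (-p)) :
    ∃ xs, Tendsto x atTop (𝓝 xs) ∧
      (fun k => ‖x k - xs‖) =O[atTop] (fun k : ℕ => (k : ℝ) ^ (-((p - 1) / 2))) := by
  obtain ⟨A, hA, hstep⟩ := hr.step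
  obtain ⟨C, hC, K, hK⟩ := hr.kl _ hθ
  obtain ⟨B, hB⟩ := hE.bound
  obtain ⟨K', hK'⟩ := eventually_atTop.1 hB
  have e : 2 * ((p + 1) / (2 * p)) = (p + 1) / p := by field_simp
  rw [e] at hK
  obtain ⟨M, -, hM⟩ := exists_le_mul_rpow_neg_of_recursion (r := r) (E := E) (p := p) (B := B)
    (by linarith) hC (K := max (max K K') 1) (le_max_right _ _)
    (fun k hk => by
      have h1 := hK' k (by omega)
      rw [Real.norm_of_nonneg (r := (k : ℝ) ^ (-p)) (by positivity)] at h1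
      exact (le_abs_self _).trans h1)
    (fun k hk => hK k (by omega))
  have hfin := exists_tendsto_isBigO_rpow_of_step_sq_le (x := x) (r := fun k => A * r k)
    (M := A * M) hp (fun k => mul_nonneg hA.le (hr.nonneg k))
    (fun k => (hstep k).trans_eq (by ring))
    (fun k hk => (mul_le_mul_of_nonneg_left (hM k hk) hA.le).trans_eq (by ring))
  simpa only [dist_eq_norm] using hfin

lemma IsKLLyapunov.exists_tendsto_isBigO_pow {x : ℕ → Rn n} {E r : ℕ → ℝ} {θ q B : ℝ}
    (hr : IsKLLyapunov x E r θ) (hθ : θ ≤ 1 / 2) (hq0 : 0 < q) (hq1 : q < 1)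
    (hB : 0 ≤ B) (hE : ∀ k, E k ≤ B * q ^ k) :
    ∃ xs, Tendsto x atTop (𝓝 xs) ∧ ∃ ρ : ℝ, 0 < ρ ∧ ρ < 1 ∧
      (fun k => ‖x k - xs‖) =O[atTop] (fun k : ℕ => ρ ^ k) := by
  obtain ⟨A, hA, hstep⟩ := hr.step
  obtain ⟨C, hC, K, hK⟩ := hr.kl _ hθ
  norm_num at hK
  obtain ⟨ρ, hρ0, hρ1, M, -, hM⟩ := exists_le_mul_pow_of_recursion (r := r) hq1 hB hC hq0 hE
    (K := K) (fun k hk => by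
      by_cases hlt : E (k + 1) < r (k + 1)
      · linarith [hK k hk hlt]
      · have h0 : 0 ≤ r k - r (k + 1) :=
          nonneg_of_mul_nonneg_right ((sq_nonneg _).trans (hstep k)) hA
        linarith [mul_nonneg hC.le h0])
  have hfin := exists_tendsto_isBigO_pow_of_step_sq_le (x := x) (r := fun k => A * r k)
    (M := A * M) hρ0 hρ1 (fun k => mul_nonneg hA.le (hr.nonneg k))
    (fun k => (hstep k).trans_eq (by ring))
    (fun k hk => (mul_le_mul_of_nonneg_left (hM k hk) hA.le).trans_eq (by ring))
  simpa only [dist_eq_norm] using hfin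

/-- The gap of the objective to its limit, corrected by the tail of the tolerances, is a Lyapunov
sequence for the algorithm. -/
lemma IsIVPGSASequence.exists_isKLLyapunov {f : Rn n → EReal} {h g : Rn n → ℝ} {L : ℝ} {ε : ℕ → ℝ}
    {H : ℕ → Matrix (Fin n) (Fin n) ℝ} {x y Δ : ℕ → Rn n} {δ : ℕ → ℝ}
    (hx : IsIVPGSASequence f h g ε H x y Δ δ) (hA : BasicAssumptions f h g L)
    (hB : LocallyLipschitzOn (effDom f) (fun x => (f x).toReal))
    (hC : ContDiffOn ℝ 1 g (denomSet g) ∧ LocallyLipschitzOn (denomSet g) (gradient g))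
    (hD : ∃ K₀ : ℕ, ∀ k ≥ K₀, δ k = 0)
    {γlow γup : ℝ} (hγlow : L / 2 < γlow) (hγ : γlow ≤ γup)
    (hHlow : ∀ k, (H k - γlow • (1 : Matrix (Fin n) (Fin n) ℝ)).PosSemidef)
    (hHup : ∀ k, (γup • (1 : Matrix (Fin n) (Fin n) ℝ) - H k).PosSemidef)
    {θ : ℝ} (hKL : IsKLFunctionWithExponent (fracObj f h g) θ)
    {E : ℕ → ℝ} (hE0 : ∀ k, 0 ≤ E k) (hεE : ∀ k, ε k ≤ E k - E (k + 1))
    (hE : Tendsto E atTop (𝓝 0)) :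
    ∃ r : ℕ → ℝ, IsKLLyapunov x E r θ := by
  have hL := hA.L_pos
  have hγup : 0 < γup := by linarith
  obtain ⟨K₀, hK₀⟩ := hD
  set c : ℕ → ℝ := fun k => ratio f h g (x k) with hc
  have hc0 : ∀ k, 0 ≤ c k := fun k => hA.ratio_nonneg (hx.mem_dom k)
  have hgpos : ∀ k, 0 < g (x k) := fun k => hA.g_pos _ (hx.mem_dom k)
  have hdec := hx.sufficient_decrease hA hHlow
  have hcE : Antitone fun k => c k + E k := by
    refine antitone_nat_of_succ_le fun k => ?_
    have h1 : 0 ≤ (γlow - L / 2) * ‖x (k + 1) - x k‖ ^ 2 + ‖Δ k‖ ^ 2 :=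
      add_nonneg (mul_nonneg (by linarith) (sq_nonneg _)) (sq_nonneg _)
    have h2 := nonneg_of_mul_nonneg_right (h1.trans (hdec k)) (hgpos (k + 1))
    have h3 := hεE k
    simp only [hc]
    linarith
  set α : ℝ := c 0 + E 0 with hα
  have hcα : ∀ k, c k ≤ α := fun k => by
    have := hcE (Nat.zero_le k)
    simp only at this
    linarith [hE0 k]
  set S := {z | z ∈ effDom f ∩ denomSet g ∧ ratio f h g z ≤ α} with hSdef
  have hS : IsCompact S := hA.isCompact_sublevel α
  have hxS : ∀ k, x k ∈ S := fun k => ⟨hx.mem_dom k, hcα k⟩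
  obtain ⟨m, hm, hgm⟩ := hA.exists_pos_le_denom α
  obtain ⟨ℓ, hℓ0, hℓ⟩ := hA.exists_lipschitz_sublevel hB hC.2 α
  obtain ⟨N, hN⟩ := hS.exists_bound_of_continuousOn
    (hC.2.continuousOn.mono (fun z (hz : z ∈ S) => hz.1.2))
  obtain ⟨G, hG⟩ := hS.exists_bound_of_continuousOn hA.g_continuous.continuousOn
  have hN0 : 0 ≤ N := (norm_nonneg _).trans (hN _ (hxS 0))
  have hgG : ∀ k, g (x k) ≤ G := fun k => (le_abs_self _).trans (hG _ (hxS k))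
  have hG0 : 0 < G := (hgpos 0).trans_le (hgG 0)
  have hα0 : 0 ≤ α := (hc0 0).trans (hcα 0)
  -- the monotone sequence `c k + E k` has a limit, which is also the limit of the values
  obtain ⟨cs, hcs⟩ : ∃ cs, Tendsto (fun k => c k + E k) atTop (𝓝 cs) :=
    ⟨_, tendsto_atTop_ciInf hcE ⟨0, by rintro _ ⟨k, rfl⟩; exact add_nonneg (hc0 k) (hE0 k)⟩⟩
  have hclim : Tendsto c atTop (𝓝 cs) := by simpa using hcs.sub hE
  set r : ℕ → ℝ := fun k => c k + E k - cs with hr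
  have hr0 : ∀ k, 0 ≤ r k := fun k => sub_nonneg.2 (hcE.le_of_tendsto hcs k)
  have hrlim : Tendsto r atTop (𝓝 0) := by simpa using hcs.sub_const cs
  have hdecr : ∀ k, (γlow - L / 2) * ‖x (k + 1) - x k‖ ^ 2 + ‖Δ k‖ ^ 2
      ≤ G * (r k - r (k + 1)) := fun k => by
    have h1 : c k + ε k - c (k + 1) ≤ r k - r (k + 1) := by
      simp only [hr]; linarith [hεE k]
    have h2 : 0 ≤ r k - r (k + 1) := by
      have := hcE (Nat.le_succ k)
      simp only [Nat.succ_eq_add_one] at this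
      simp only [hr]; linarith
    calc _ ≤ g (x (k + 1)) * (c k + ε k - c (k + 1)) := hdec k
      _ ≤ g (x (k + 1)) * (r k - r (k + 1)) := mul_le_mul_of_nonneg_left h1 (hgpos _).le
      _ ≤ _ := mul_le_mul_of_nonneg_right (hgG _) h2
  set σ := γlow - L / 2 with hσ
  have hσ0 : 0 < σ := by rw [hσ]; linarith
  have hstep : ∀ k, ‖x (k + 1) - x k‖ ^ 2 ≤ G / σ * (r k - r (k + 1)) := fun k => by
    rw [div_mul_eq_mul_div, le_div_iff₀ hσ0]
    linarith [hdecr k, sq_nonneg ‖Δ k‖]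
  have herr : ∀ k, ‖Δ k‖ ^ 2 ≤ G * (r k - r (k + 1)) := fun k => by
    linarith [hdecr k, mul_nonneg hσ0.le (sq_nonneg ‖x (k + 1) - x k‖)]
  -- small subgradients along the tail
  set b : ℝ := m⁻¹ * max 1 (L + γup + α * ℓ + ℓ * N) with hb
  have hb0 : 0 < b := mul_pos (inv_pos.2 hm) (zero_lt_one.trans_le (le_max_left _ _))
  have hsub : ∀ k, ∃ v ∈ regSubdiff (fracObj f h g) (x (k + K₀ + 1)),
      ‖v‖ ^ 2 ≤ 2 * b ^ 2 * (G + G / σ) * (r (k + K₀) - r (k + K₀ + 1)) := fun j => by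
    set k := j + K₀
    obtain ⟨v, hv, hvn⟩ := hx.exists_mem_regSubdiff hA hC.1 hγup hHup (hK₀ k (by omega))
    refine ⟨v, hv, ?_⟩
    set s := ‖x (k + 1) - x k‖ with hs
    have hs0 : 0 ≤ s := norm_nonneg _
    obtain ⟨h1, h2⟩ := hℓ _ (hx.mem_dom k) (hcα k) _ (hx.mem_dom (k + 1)) (hcα (k + 1))
    rw [norm_sub_rev (x k)] at h1 h2
    have h3 : ‖v‖ ≤ b * (‖Δ k‖ + s) := by
      have h4 : c k * ‖gradient g (x k) - gradient g (x (k + 1))‖ ≤ α * (ℓ * s) :=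
        mul_le_mul (hcα k) h2 (norm_nonneg _) hα0
      have h5 : |c k - c (k + 1)| * ‖gradient g (x (k + 1))‖ ≤ ℓ * s * N :=
        mul_le_mul h1 (hN _ (hxS _)) (norm_nonneg _) (by positivity)
      have h6 : (g (x (k + 1)))⁻¹ ≤ m⁻¹ :=
        inv_anti₀ hm (hgm _ (hx.mem_dom _) (hcα _))
      have h7 : ‖Δ k‖ ≤ max 1 (L + γup + α * ℓ + ℓ * N) * ‖Δ k‖ :=
        le_mul_of_one_le_left (norm_nonneg _) (le_max_left _ _)
      have h8 : (L + γup + α * ℓ + ℓ * N) * s ≤ max 1 (L + γup + α * ℓ + ℓ * N) * s :=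
        mul_le_mul_of_nonneg_right (le_max_right _ _) hs0
      refine hvn.trans ?_
      rw [hb, mul_assoc]
      refine mul_le_mul h6 (by simp only [hc] at h4 h5; linarith) ?_ (inv_nonneg.2 hm.le)
      have := hc0 k
      positivity
    calc ‖v‖ ^ 2 ≤ (b * (‖Δ k‖ + s)) ^ 2 := pow_le_pow_left₀ (norm_nonneg _) h3 2
      _ ≤ 2 * b ^ 2 * (‖Δ k‖ ^ 2 + s ^ 2) := by
        nlinarith [mul_nonneg (sq_nonneg b) (sq_nonneg (‖Δ k‖ - s))]
      _ ≤ 2 * b ^ 2 * (G * (r k - r (k + 1)) + G / σ * (r k - r (k + 1))) := by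
        gcongr
        · exact herr k
        · exact hstep k
      _ = _ := by ring
  choose v hv hvb using hsub
  set b' : ℝ := 2 * b ^ 2 * (G + G / σ) with hb'
  have hb'0 : 0 < b' := by positivity
  have hv0 : Tendsto v atTop (𝓝 0) := by
    have h1 : Tendsto (fun k => r (k + K₀) - r (k + K₀ + 1)) atTop (𝓝 0) := by
      simpa [add_assoc] using ((tendsto_add_atTop_iff_nat K₀).2 hrlim).sub
        ((tendsto_add_atTop_iff_nat (K₀ + 1)).2 hrlim)
    have h2 : Tendsto (fun k => ‖v k‖ ^ 2) atTop (𝓝 0) :=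
      squeeze_zero (fun _ => sq_nonneg _) hvb (by simpa using h1.const_mul b')
    rw [tendsto_zero_iff_norm_tendsto_zero]
    simpa using h2.sqrt
  refine ⟨r, hr0, ⟨G / σ, by positivity, fun k => ?_⟩, fun θ' hθ' => ?_⟩
  · rw [dist_comm, dist_eq_norm]; exact hstep k
  obtain ⟨A, hApos, hev⟩ := hKL.eventually_mul_rpow_le hθ' hS
    ((hA.continuousOn_ratio hB).mono fun z (hz : z ∈ S) => hz.1)
    (fun z hz => fracObj_of_mem hz.1) (fun k => hxS (k + K₀ + 1)) hv hv0
    ((tendsto_add_atTop_iff_nat (K₀ + 1)).2 hclim)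
  obtain ⟨K, hK⟩ := eventually_atTop.1 hev
  refine ⟨b' / A ^ 2, by positivity, K + K₀, fun k hk hlt => ?_⟩
  obtain ⟨j, rfl⟩ : ∃ j, k = j + K₀ := ⟨k - K₀, by omega⟩
  have hgap : r (j + K₀ + 1) - E (j + K₀ + 1) = c (j + K₀ + 1) - cs := by
    simp only [hr]; ring
  have hcpos : 0 < c (j + K₀ + 1) - cs := by rw [← hgap]; exact sub_pos.2 hlt
  have h1 : A * (c (j + K₀ + 1) - cs) ^ θ' ≤ ‖v j‖ := hK j (by omega) (sub_pos.1 hcpos)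
  rw [hgap, div_mul_eq_mul_div, le_div_iff₀ (by positivity)]
  calc (c (j + K₀ + 1) - cs) ^ (2 * θ') * A ^ 2 = (A * (c (j + K₀ + 1) - cs) ^ θ') ^ 2 := by
        rw [mul_pow, ← Real.rpow_natCast (_ ^ θ'), ← Real.rpow_mul hcpos.le]
        push_cast
        rw [mul_comm θ' 2, mul_comm]
    _ ≤ ‖v j‖ ^ 2 := pow_le_pow_left₀ (by positivity) h1 2
    _ ≤ _ := hvb j

/-! ### Geometric and polynomial tolerances -/

lemma one_div_add_one_div_two_mul_one_div {t : ℝ} (ht : 0 < t) :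
    (1 / t + 1) / (2 * (1 / t)) = (1 + t) / 2 := by
  field_simp

lemma isBigO_pow_rpow_neg {q : ℝ} (hq0 : 0 < q) (hq1 : q < 1) (B p : ℝ) :
    (fun k : ℕ => B * q ^ k) =O[atTop] fun k : ℕ => (k : ℝ) ^ (-p) := by
  have h := (isLittleO_exp_neg_mul_rpow_atTop (neg_pos.2 (Real.log_neg hq0 hq1)) (-p)).comp_tendsto
    tendsto_natCast_atTop_atTop
  refine (IsBigO.const_mul_left ?_ B)
  refine h.isBigO.congr_left fun k => ?_
  simp only [Function.comp, neg_neg]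
  rw [mul_comm, Real.exp_nat_mul, Real.exp_log hq0]

lemma isBigO_succ_rpow_neg {s p : ℝ} (hs : 0 ≤ s) (hps : p ≤ s) (B : ℝ) :
    (fun k : ℕ => B * ((k : ℝ) + 1) ^ (-s)) =O[atTop] fun k : ℕ => (k : ℝ) ^ (-p) := by
  refine IsBigO.const_mul_left (IsBigO.of_bound 1 ?_) B
  filter_upwards [eventually_ge_atTop 1] with k hk
  have hk1 : (1 : ℝ) ≤ k := by exact_mod_cast hk
  rw [Real.norm_of_nonneg (by positivity), Real.norm_of_nonneg (by positivity), one_mul]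
  calc ((k : ℝ) + 1) ^ (-s) ≤ (k : ℝ) ^ (-s) :=
        Real.rpow_le_rpow_of_nonpos (by linarith) (by linarith) (by linarith)
    _ ≤ _ := Real.rpow_le_rpow_of_exponent_le hk1 (by linarith)

/-- The explicit tail `2 ^ q / (q - 1) * (k + 1) ^ (-(q - 1))` dominates the remainders of the
series of `1 / (k + 1) ^ q`. -/
lemma one_div_rpow_le_tail_sub {q : ℝ} (hq : 1 < q) (k : ℕ) :
    1 / ((k : ℝ) + 1) ^ q ≤ 2 ^ q / (q - 1) * ((k : ℝ) + 1) ^ (-(q - 1))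
      - 2 ^ q / (q - 1) * (((k + 1 : ℕ) : ℝ) + 1) ^ (-(q - 1)) := by
  have hk : (0 : ℝ) < (k : ℝ) + 1 := by positivity
  have hk2 : (0 : ℝ) < (k : ℝ) + 1 + 1 := by positivity
  have hq1 : 0 < q - 1 := by linarith
  have h1 := Real.rpow_neg_ge_tangent hq1.le hk2 hk
  rw [sub_add_cancel] at h1
  have h2 : 1 / ((k : ℝ) + 1) ^ q ≤ 2 ^ q * ((k : ℝ) + 1 + 1) ^ (-q) := by
    rw [Real.rpow_neg hk2.le, ← div_eq_mul_inv, div_le_div_iff₀ (by positivity) (by positivity),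
      one_mul, ← Real.mul_rpow (by norm_num) hk.le]
    exact Real.rpow_le_rpow hk2.le (by linarith [(Nat.cast_nonneg k : (0 : ℝ) ≤ k)]) (by linarith)
  push_cast
  rw [← mul_sub, div_mul_eq_mul_div, le_div_iff₀ hq1]
  calc 1 / ((k : ℝ) + 1) ^ q * (q - 1) ≤ 2 ^ q * ((k : ℝ) + 1 + 1) ^ (-q) * (q - 1) := by gcongr
    _ = 2 ^ q * ((q - 1) * ((k : ℝ) + 1 + 1) ^ (-q)) := by ring
    _ ≤ _ := by
      gcongr
      linarith

theorem theorem4p3 {n : ℕ} (f : Rn n → EReal) (h g : Rn n → ℝ) (L : ℝ)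
    (hA : BasicAssumptions f h g L)
    -- `f` is locally Lipschitz on its domain
    (hB : LocallyLipschitzOn (effDom f) (fun x => (f x).toReal))
    -- `g` is continuously differentiable on the open set `Ω`, with locally Lipschitz gradient
    (hC : ContDiffOn ℝ 1 g (denomSet g) ∧ LocallyLipschitzOn (denomSet g) (gradient g))
    -- the tolerances, the metrics, and a sequence generated by the algorithm
    (ε : ℕ → ℝ) (H : ℕ → Matrix (Fin n) (Fin n) ℝ) (x y Δ : ℕ → Rn n) (δ : ℕ → ℝ)
    (hx : IsIVPGSASequence f h g ε H x y Δ δ)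
    -- the errors `δ k` vanish eventually
    (hD : ∃ K₀ : ℕ, ∀ k ≥ K₀, δ k = 0)
    -- uniform bounds on the metrics, in the Loewner order
    (γlow γup : ℝ) (hγlow : L / 2 < γlow) (hγ : γlow ≤ γup)
    (hHlow : ∀ k, (H k - γlow • (1 : Matrix (Fin n) (Fin n) ℝ)).PosSemidef)
    (hHup : ∀ k, (γup • (1 : Matrix (Fin n) (Fin n) ℝ) - H k).PosSemidef)
    -- `F` is a KL function with exponent `θ`
    (θ : ℝ) (hθ0 : 0 ≤ θ) (hθ1 : θ < 1)
    (hKL : IsKLFunctionWithExponent (fracObj f h g) θ)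
    (ε₀ : ℝ) (hε₀ : 0 < ε₀) :
    -- geometric errors
    (∀ q : ℝ, 0 < q → q < 1 → (∀ k, ε k = ε₀ * q ^ k) →
      ∃ xs : Rn n, Tendsto x atTop (𝓝 xs) ∧
        (θ ≤ 1 / 2 → ∃ ρ : ℝ, 0 < ρ ∧ ρ < 1 ∧
          (fun k => ‖x k - xs‖) =O[atTop] (fun k : ℕ => ρ ^ k)) ∧
        (1 / 2 < θ →
          (fun k => ‖x k - xs‖) =O[atTop]
            (fun k : ℕ => (k : ℝ) ^ (-((1 - θ) / (2 * θ - 1)))))) ∧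
    -- polynomial errors
    (∀ q : ℝ, 2 < q → (∀ k, ε k = ε₀ / ((k : ℝ) + 1) ^ q) →
      ∃ xs : Rn n, Tendsto x atTop (𝓝 xs) ∧
        (θ ≤ 1 / 2 →
          (fun k => ‖x k - xs‖) =O[atTop] (fun k : ℕ => (k : ℝ) ^ (-(q / 2 - 1)))) ∧
        (1 / 2 < θ → q < 2 * θ / (2 * θ - 1) →
          (fun k => ‖x k - xs‖) =O[atTop] (fun k : ℕ => (k : ℝ) ^ (-(q / 2 - 1)))) ∧
        (1 / 2 < θ → 2 * θ / (2 * θ - 1) ≤ q →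
          (fun k => ‖x k - xs‖) =O[atTop]
            (fun k : ℕ => (k : ℝ) ^ (-((1 - θ) / (2 * θ - 1)))))) := by
  constructor
  · intro q hq0 hq1 hε
    have hq : 0 < 1 - q := by linarith
    obtain ⟨r, hr⟩ := hx.exists_isKLLyapunov hA hB hC hD hγlow hγ hHlow hHup hKL
      (E := fun k => ε₀ / (1 - q) * q ^ k) (fun k => by positivity)
      (fun k => by
        rw [hε]
        refine le_of_eq ?_
        field_simp
        ring)
      (by simpa using (tendsto_pow_atTop_nhds_zero_of_lt_one hq0.le hq1).const_mul (ε₀ / (1 - q)))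
    rcases le_or_gt θ (1 / 2) with hθ | hθ
    · obtain ⟨xs, hxs, hrate⟩ :=
        hr.exists_tendsto_isBigO_pow hθ hq0 hq1 (by positivity) fun k => le_rfl
      exact ⟨xs, hxs, fun _ => hrate, fun h' => absurd h' hθ.not_gt⟩
    · have hp : 0 < 2 * θ - 1 := by linarith
      have hθp : θ = (1 / (2 * θ - 1) + 1) / (2 * (1 / (2 * θ - 1))) := by
        rw [one_div_add_one_div_two_mul_one_div hp]
        ring
      obtain ⟨xs, hxs, hrate⟩ := hr.exists_tendsto_isBigO_rpow (p := 1 / (2 * θ - 1))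
        (by rw [lt_div_iff₀ hp]; linarith) hθp.le
        (isBigO_pow_rpow_neg hq0 hq1 _ _)
      have e : (1 / (2 * θ - 1) - 1) / 2 = (1 - θ) / (2 * θ - 1) := by field_simp; ring
      rw [e] at hrate
      exact ⟨xs, hxs, fun h' => absurd hθ h'.not_gt, fun _ => hrate⟩
  · intro q hq2 hε
    have hq : 0 < q - 1 := by linarith
    obtain ⟨r, hr⟩ := hx.exists_isKLLyapunov hA hB hC hD hγlow hγ hHlow hHup hKL
      (E := fun k => ε₀ * (2 ^ q / (q - 1) * ((k : ℝ) + 1) ^ (-(q - 1))))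
      (fun k => by positivity)
      (fun k => by
        rw [hε, ← mul_sub, div_eq_mul_one_div]
        exact mul_le_mul_of_nonneg_left (one_div_rpow_le_tail_sub (by linarith) k) hε₀.le)
      (by
        have h1 := ((tendsto_rpow_neg_atTop hq).comp
          (tendsto_natCast_atTop_atTop.atTop_add (tendsto_const_nhds (x := (1 : ℝ)))))
        simpa [Function.comp_def] using (h1.const_mul (2 ^ q / (q - 1))).const_mul ε₀)
    have hE : ∀ p ≤ q - 1, (fun k : ℕ => ε₀ * (2 ^ q / (q - 1) * ((k : ℝ) + 1) ^ (-(q - 1))))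
        =O[atTop] fun k : ℕ => (k : ℝ) ^ (-p) := fun p hp =>
      (isBigO_succ_rpow_neg hq.le hp _).const_mul_left ε₀
    have e1 : (q - 1 - 1) / 2 = q / 2 - 1 := by ring
    rcases le_or_gt θ (1 / 2) with hθ | hθ
    · obtain ⟨xs, hxs, hrate⟩ := hr.exists_tendsto_isBigO_rpow (p := q - 1) (by linarith)
        (by rw [le_div_iff₀ (by linarith)]; nlinarith) (hE _ le_rfl)
      rw [e1] at hrate
      exact ⟨xs, hxs, fun _ => hrate, fun _ _ => hrate, fun h' => absurd h' hθ.not_gt⟩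
    have hp : 0 < 2 * θ - 1 := by linarith
    have hθp : θ = (1 / (2 * θ - 1) + 1) / (2 * (1 / (2 * θ - 1))) := by
      rw [one_div_add_one_div_two_mul_one_div hp]
      ring
    rcases lt_or_ge q (2 * θ / (2 * θ - 1)) with hqθ | hqθ
    · have hqθ' := (lt_div_iff₀ hp).1 hqθ
      obtain ⟨xs, hxs, hrate⟩ := hr.exists_tendsto_isBigO_rpow (p := q - 1) (by linarith)
        (by rw [le_div_iff₀ (by linarith)]; linarith) (hE _ le_rfl)
      rw [e1] at hrate
      exact ⟨xs, hxs, fun _ => hrate, fun _ _ => hrate, fun _ h' => absurd hqθ h'.not_gt⟩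
    · have hpq : 1 / (2 * θ - 1) ≤ q - 1 := by
        have e : 2 * θ / (2 * θ - 1) = 1 / (2 * θ - 1) + 1 := by field_simp; ring
        linarith
      obtain ⟨xs, hxs, hrate⟩ := hr.exists_tendsto_isBigO_rpow (p := 1 / (2 * θ - 1))
        (by rw [lt_div_iff₀ hp]; linarith) hθp.le (hE _ hpq)
      have e : (1 / (2 * θ - 1) - 1) / 2 = (1 - θ) / (2 * θ - 1) := by field_simp; ring
      rw [e] at hrate
      exact ⟨xs, hxs, fun h' => absurd hθ h'.not_gt, fun _ h' => absurd h' hqθ.not_gt,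
        fun _ _ => hrate⟩
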